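/- All Hilbert spaces are finite-dimensional. A channel is a completely positive trace-preserving linear map, and for a unitary $U$ write $\mathcal U(X)=UXU^\dagger$. For two channels with the same input and output put $$\epsilon_{\rm wc}(\mathcal A,\mathcal B)=\tfrac12\|\mathcal A-\mathcal B\|_\diamond=\tfrac12\sup_{\rho}\big\|(\mathcal A\otimes\mathcal I)(\rho)-(\mathcal B\otimes\mathcal I)(\rho)\big\|_1 ,$$ the supremum being over all states $\rho$ of the input together with an arbitrary finite-dimensional reference system. For a family of channels $(\mathcal C_\theta)_{\theta\in\mathbb R}$ and a point $\theta$ let $$I^{\uparrow}_{\rm Fisher}=\inf\;4\Big\|\sum_l \dot K_{l;\theta}^\dagger\dot K_{l;\theta}\Big\|_\infty ,$$ where the infimum is over all finite Kraus forms $\{K_{l;\theta}\}_l$ of $(\mathcal C_\theta)$ that are differentiable at $\theta$ and satisfy $\sum_l\dot K_{l;\theta}^\dagger K_{l;\theta}=0$ there, and $I^{\uparrow}_{\rm Fisher}=\infty$ if there is no such Kraus form. Let $\Delta H$ be the difference between the largest and the smallest eigenvalue of a Hermitian operator $H$. (1) $U(1)$-covariant codes. Let $H$ and $H_{\rm P}$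 be Hermitian operators on a (nonzero) logical and on a physical space, $U_\theta=e^{-i\theta H}$ and $U_{{\rm P},\theta}=e^{-i\theta H_{\rm P}}$. Let $\mathcal E$ (encoder, logical to physical), $\mathcal C$ (noise, from the physical system to any system) and $\mathcal D$ (decoder, from the output of $\mathcal C$ to the logical system) be channels such that $\mathcal E\circ\mathcal U_\theta=\mathcal U_{{\rm P},\theta}\circ\mathcal E$ for all $\theta\in\mathbb R$, and put $\epsilon_{\rm cov}=\sup_\theta\epsilon_{\rm wc}(\mathcal D\circ\mathcal C\circ\mathcal U_{{\rm P},\theta}\circ\mathcal E,\;\mathcal U_\theta)$. If $\epsilon_{\rm cov}\le\frac14$, then $$\epsilon_{\rm cov}\;\ge\;\frac{(\Delta H)^2}{16\,I^{\uparrow}_{\rm Fisher}},$$ where $I^{\uparrow}_{\rm Fisher}$ is that of the family $\mathcal C_\theta=\mathcal C\circ\mathcal U_{{\rm P},\theta}$ at any $\theta$ (with $x/\infty=0$, $x/0=\infty$ for $x>0$, and $0/0=0$). (2) $SU(d)$-covariant codes. Let $d\ge1$, let the logical system be a qudit $\mathbb C^d$ and the physical system $n$ qudits. For a $d\times d$ unitary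 $V$ let $V_{\rm P}=V_1\otimes\cdots\otimes V_n$, where each $V_i$ is $V$ or the identity, according to a fixed set of positions. Let $\mathcal E,\mathcal C,\mathcal D$ be channels as above with $\mathcal E\circ\mathcal V=\mathcal V_{\rm P}\circ\mathcal E$ for all $V\in SU(d)$, and put $\epsilon_{\rm cov}=\sup_{V\in SU(d)}\epsilon_{\rm wc}(\mathcal D\circ\mathcal C\circ\mathcal V_{\rm P}\circ\mathcal E,\;\mathcal V)$. If $\epsilon_{\rm cov}\le\frac14$, then for every Hermitian $d\times d$ matrix $H$ the same inequality holds, where $I^{\uparrow}_{\rm Fisher}$ is that of the family $\mathcal C_\theta=\mathcal C\circ\mathcal U_{{\rm P},\theta}$, with $U_{{\rm P},\theta}=V_{\rm P}$ for $V=e^{-i\theta H}$. -/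

import Mathlib

open Matrix
open scoped ENNReal ComplexOrder

namespace CovariantCode

noncomputable section

/-- `Φ ⊗ id` on operators of `ℂ^A ⊗ ℂ^k`: the map `Φ` is applied to every `A × A` block. -/
def ampliate {A B : Type*} (k : ℕ) (Φ : Matrix A A ℂ →ₗ[ℂ] Matrix B B ℂ)
    (X : Matrix (A × Fin k) (A × Fin k) ℂ) : Matrix (B × Fin k) (B × Fin k) ℂ :=
  Matrix.of fun p q => Φ (Matrix.of fun i j => X (i, p.2) (j, q.2)) p.1 q.1

/-- A quantum channel: a completely positive trace-preserving linear map. -/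
structure IsChannel {A B : Type*} [Fintype A] [Fintype B]
    (Φ : Matrix A A ℂ →ₗ[ℂ] Matrix B B ℂ) : Prop where
  completely_positive : ∀ (k : ℕ) (X : Matrix (A × Fin k) (A × Fin k) ℂ),
    X.PosSemidef → (ampliate k Φ X).PosSemidef
  trace_preserving : ∀ X : Matrix A A ℂ, (Φ X).trace = X.trace

/-- The map `X ↦ U X U†`. -/
def conjMap {A : Type*} [Fintype A] [DecidableEq A] (U : Matrix A A ℂ) :
    Matrix A A ℂ →ₗ[ℂ] Matrix A A ℂ :=
  LinearMap.mulLeft ℂ U ∘ₗ LinearMap.mulRight ℂ Uᴴ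

/-- The trace norm: the sum of the singular values. -/
def traceNorm {A : Type*} [Fintype A] [DecidableEq A] (M : Matrix A A ℂ) : ℝ :=
  ∑ i, Real.sqrt ((isHermitian_conjTranspose_mul_self M).eigenvalues i)

/-- The operator norm for the Euclidean norm. -/
def opNorm {A : Type*} [Fintype A] [DecidableEq A] (M : Matrix A A ℂ) : ℝ :=
  ‖Matrix.toEuclideanCLM (n := A) (𝕜 := ℂ) M‖

/-- The diamond-norm (worst-case input) error
`½ sup_ρ ‖(Φ ⊗ id)(ρ) - (Ψ ⊗ id)(ρ)‖₁`, over all density operators `ρ` on the input together with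
an arbitrary finite-dimensional reference system. -/
def diamondError {A B : Type*} [Fintype A] [Fintype B] [DecidableEq B]
    (Φ Ψ : Matrix A A ℂ →ₗ[ℂ] Matrix B B ℂ) : ℝ≥0∞ :=
  ⨆ (k : ℕ) (ρ : Matrix (A × Fin k) (A × Fin k) ℂ) (_ : ρ.PosSemidef ∧ ρ.trace = 1),
    ENNReal.ofReal (1 / 2 * traceNorm (ampliate k Φ ρ - ampliate k Ψ ρ))

/-- The operators `K l` are a Kraus form of `Φ`. -/
def IsKrausForm {A B : Type*} [Fintype A] {r : ℕ}
    (Φ : Matrix A A ℂ →ₗ[ℂ] Matrix B B ℂ) (K : Fin r → Matrix B A ℂ) : Prop :=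
  ∀ X : Matrix A A ℂ, Φ X = ∑ l, K l * X * (K l)ᴴ

/-- The Fisher information upper bound of the channel family `Φ` at `θ`: the infimum of
`4 ‖∑ K̇†K̇‖` over the Kraus forms `K` of the family that are differentiable at `θ` (with
derivative `K'`) and satisfy `∑ K̇†K = 0` there; it is `∞` if there is no such Kraus form. -/
def fisherUpperBound {A B : Type*} [Fintype A] [DecidableEq A] [Fintype B]
    (Φ : ℝ → Matrix A A ℂ →ₗ[ℂ] Matrix B B ℂ) (θ : ℝ) : ℝ≥0∞ :=
  ⨅ (r : ℕ) (K : ℝ → Fin r → Matrix B A ℂ) (K' : Fin r → Matrix B A ℂ)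
    (_ : (∀ t, IsKrausForm (Φ t) (K t)) ∧
      (∀ l b a, HasDerivAt (fun t => K t l b a) (K' l b a) θ) ∧
      ∑ l, (K' l)ᴴ * K θ l = 0),
    ENNReal.ofReal (4 * opNorm (∑ l, (K' l)ᴴ * K' l))

/-- The unitary `exp (-i θ H)`. -/
def evolution {A : Type*} [Fintype A] [DecidableEq A] (H : Matrix A A ℂ) (θ : ℝ) :
    Matrix A A ℂ :=
  NormedSpace.exp ((-(Complex.I * (θ : ℂ))) • H)

/-- The difference between the largest and the smallest eigenvalue. -/
def spectralSpread {A : Type*} [Fintype A] [DecidableEq A] {H : Matrix A A ℂ}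
    (hH : H.IsHermitian) : ℝ :=
  (⨆ i, hH.eigenvalues i) - ⨅ i, hH.eigenvalues i

/-- The encoder `E` is covariant for the logical unitaries `VL g` and the physical
unitaries `VP g`. -/
def IsCovariant {G L P : Type*} [Fintype L] [DecidableEq L] [Fintype P] [DecidableEq P]
    (VL : G → Matrix L L ℂ) (VP : G → Matrix P P ℂ)
    (E : Matrix L L ℂ →ₗ[ℂ] Matrix P P ℂ) : Prop :=
  ∀ g, E ∘ₗ conjMap (VL g) = conjMap (VP g) ∘ₗ E

/-- The error of the code `(E, D)` under the noise `C`: the worst diamond-norm error, over all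
`g`, between `D ∘ C ∘ VP g ∘ E` and the logical gate `VL g`. -/
def codeError {G L P Q : Type*} [Fintype L] [DecidableEq L] [Fintype P] [DecidableEq P]
    (VL : G → Matrix L L ℂ) (VP : G → Matrix P P ℂ)
    (E : Matrix L L ℂ →ₗ[ℂ] Matrix P P ℂ) (C : Matrix P P ℂ →ₗ[ℂ] Matrix Q Q ℂ)
    (D : Matrix Q Q ℂ →ₗ[ℂ] Matrix L L ℂ) : ℝ≥0∞ :=
  ⨆ g, diamondError (D ∘ₗ C ∘ₗ conjMap (VP g) ∘ₗ E) (conjMap (VL g))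

/-- The transversal action `V₁ ⊗ ⋯ ⊗ Vₙ` on `n` qudits, where `Vᵢ = V` for `i ∈ S` and
`Vᵢ = 1` otherwise. -/
def transversal {d n : ℕ} (S : Finset (Fin n)) (V : Matrix (Fin d) (Fin d) ℂ) :
    Matrix (Fin n → Fin d) (Fin n → Fin d) ℂ :=
  Matrix.of fun a b => ∏ i, (if i ∈ S then V else 1) (a i) (b i)

end

end CovariantCode

open CovariantCode

/-! Fix a time `θ` and orthonormal eigenvectors `e₀`, `e₁` of the logical Hamiltonian with energy
gap `δ`. By covariance the encoded, noisy and decoded evolution is a fixed channel after the logical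
rotation, so it multiplies the coherence `|e₁⟩⟨e₀|` by a phase of speed `δ`. An accurate code keeps
this coherence: for the Hermitian unitary `X` that exchanges the rotated eigenvectors, its
`X`-expectation has modulus `F ≥ 1 - 2ε` (`one_sub_le_norm_coherence`).

The same expectation is the overlap of two unit vectors, obtained by stacking the Kraus operators
`Nⱼ` applied to `e₀` and `X Nⱼ` applied to `e₁`. The condition `∑ K̇†K = 0` makes their velocities
orthogonal to them, and the squared speeds are at most `α = ‖∑ K̇†K̇‖`. An overlap close to one in
modulus can then change only slowly (`norm_deriv_overlap_sq_le`), which gives `δ² F² ≤ 4α (1 - F²)`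
(`speed_sq_mul_overlap_sq_le`). For `ε ≤ 1/4` this yields `δ² ≤ 64 ε α = 16 ε · 4α`
(`energy_gap_sq_le`); extremal eigenvectors and the infimum over Kraus forms finish part (1).

Part (2) reduces to the same bound: `e^{-iθH}` is a phase times a special unitary, and conjugations
do not see phases. -/

namespace CovariantCode

/-! ### Unitary conjugation and Hamiltonian evolution -/

section ConjMap

variable {A : Type*} [Fintype A] [DecidableEq A]

lemma conjMap_apply (U X : Matrix A A ℂ) : conjMap U X = U * X * Uᴴ := by
  simp [conjMap, Matrix.mul_assoc]

lemma conjMap_vecMulVec (U : Matrix A A ℂ) (x y : A → ℂ) :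
    conjMap U (vecMulVec x (star y)) = vecMulVec (U *ᵥ x) (star (U *ᵥ y)) := by
  rw [conjMap_apply, mul_vecMulVec, vecMulVec_mul, star_mulVec]

lemma conjMap_smul (c : ℂ) (hc : c * star c = 1) (U : Matrix A A ℂ) :
    conjMap (c • U) = conjMap U := by
  ext1 X
  simp only [conjMap_apply, conjTranspose_smul, Matrix.smul_mul, Matrix.mul_smul, smul_smul]
  rw [mul_comm, hc, one_smul]

end ConjMap

section Evolution

variable {A : Type*} [Fintype A] [DecidableEq A]

open scoped Matrix.Norms.Operator in
lemma exp_mulVec_of_eigenvector {M : Matrix A A ℂ} {v : A → ℂ} {c : ℂ} (h : M *ᵥ v = c • v) :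
    NormedSpace.exp M *ᵥ v = Complex.exp c • v := by
  have hpow : ∀ n : ℕ, (M ^ n) *ᵥ v = c ^ n • v := by
    intro n
    induction n with
    | zero => simp
    | succ n ih => rw [pow_succ, ← mulVec_mulVec, h, mulVec_smul, ih, smul_smul, pow_succ']
  let φ : Matrix A A ℂ →+ (A → ℂ) :=
    { toFun := fun N => N *ᵥ v
      map_zero' := zero_mulVec v
      map_add' := fun N N' => add_mulVec N N' v }
  have hφ : Continuous φ := by
    change Continuous fun N : Matrix A A ℂ => N *ᵥ v
    fun_prop
  have h1 := (NormedSpace.exp_series_hasSum_exp' (𝕂 := ℂ) M).map φ hφ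
  have h2 := (NormedSpace.exp_series_hasSum_exp' (𝕂 := ℂ) c).smul_const v
  rw [← Complex.exp_eq_exp_ℂ] at h2
  refine h1.unique ?_
  convert h2 using 2 with n
  change (((n.factorial : ℂ)⁻¹) • M ^ n) *ᵥ v = _
  rw [smul_mulVec, hpow, smul_smul, smul_eq_mul]

lemma evolution_mulVec_of_eigenvector {H : Matrix A A ℂ} {v : A → ℂ} {a : ℝ}
    (h : H *ᵥ v = (a : ℂ) • v) (θ : ℝ) :
    evolution H θ *ᵥ v = Complex.exp (-(Complex.I * θ) * a) • v := by
  refine exp_mulVec_of_eigenvector ?_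
  rw [smul_mulVec, h, smul_smul]

lemma evolution_mul_conjTranspose {H : Matrix A A ℂ} (hH : H.IsHermitian) (θ : ℝ) :
    evolution H θ * (evolution H θ)ᴴ = 1 := by
  have h : (evolution H θ)ᴴ = evolution H (-θ) := by
    rw [evolution, ← exp_conjTranspose, conjTranspose_smul, hH.eq, evolution]
    congr 2
    simp
  rw [h, evolution, evolution, ← Matrix.exp_add_of_commute]
  · rw [← add_smul]; simp
  · exact (Commute.refl H).smul_left _ |>.smul_right _

end Evolution

/-! ### Kraus forms and the Heisenberg picture -/

section Kraus

variable {A B : Type*} [Fintype A] [Fintype B]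

/-- Every channel has a Kraus form. -/
lemma IsChannel.exists_isKrausForm {Φ : Matrix A A ℂ →ₗ[ℂ] Matrix B B ℂ} (hΦ : IsChannel Φ) :
    ∃ (r : ℕ) (K : Fin r → Matrix B A ℂ), IsKrausForm Φ K := by
  classical
  let e := Fintype.equivFin A
  -- An unnormalised maximally entangled vector. The image of its projector is the Choi matrix, and
  -- the rank-one terms of that matrix, reshaped, are the Kraus operators.
  let w : A × Fin (Fintype.card A) → ℂ := fun p => if e p.1 = p.2 then 1 else 0
  have hpos := hΦ.completely_positive _ _ (posSemidef_vecMulVec_self_star w)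
  obtain ⟨r, v, hv⟩ := posSemidef_iff_eq_sum_vecMulVec.mp hpos
  refine ⟨r, fun l => Matrix.of fun b i => v l (b, e i), fun X => ?_⟩
  have key : ∀ i j b b', Φ (Matrix.single i j 1) b b' =
      ∑ l, v l (b, e i) * star (v l (b', e j)) := by
    intro i j b b'
    have h := congrFun (congrFun hv (b, e i)) (b', e j)
    rw [Matrix.sum_apply] at h
    refine Eq.trans ?_ h
    refine congrArg (fun Z => Φ Z b b') ?_
    ext i' j'
    simp [w, vecMulVec_apply, Matrix.single_apply, eq_comm, ← ite_and, and_comm]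
  conv_lhs => rw [matrix_eq_sum_single X]
  ext b b'
  have hs : ∀ i j, Matrix.single i j (X i j) = X i j • Matrix.single i j (1 : ℂ) := by simp
  simp only [map_sum, Matrix.sum_apply, hs, map_smul, Matrix.smul_apply, key, smul_eq_mul,
    mul_apply, conjTranspose_apply, of_apply, Finset.sum_mul, Finset.mul_sum]
  rw [Finset.sum_comm]
  rw [Finset.sum_congr rfl fun i _ => Finset.sum_comm, Finset.sum_comm]
  refine Finset.sum_congr rfl fun l _ => ?_
  rw [Finset.sum_comm]
  rw [Finset.sum_comm]
  refine Finset.sum_congr rfl fun i _ => Finset.sum_congr rfl fun j _ => ?_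
  ring

/-- Passes to the Heisenberg picture by cyclicity of the trace. -/
lemma trace_sum_mul_mul_conjTranspose {J : Type*} [Fintype J] (K : J → Matrix B A ℂ)
    (X : Matrix A A ℂ) (Y : Matrix B B ℂ) :
    (Y * ∑ j, K j * X * (K j)ᴴ).trace = ((∑ j, (K j)ᴴ * Y * K j) * X).trace := by
  rw [Finset.mul_sum, Finset.sum_mul, trace_sum, trace_sum]
  refine Finset.sum_congr rfl fun j _ => ?_
  rw [trace_mul_comm, Matrix.mul_assoc, Matrix.mul_assoc, trace_mul_comm, trace_mul_comm,
    ← Matrix.mul_assoc, trace_mul_comm]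
  simp only [Matrix.mul_assoc]

/-- The Kraus operators of a trace-preserving map satisfy the completeness relation. -/
lemma sum_conjTranspose_mul_eq_one [DecidableEq A] {J : Type*} [Fintype J]
    {K : J → Matrix B A ℂ} (h : ∀ X : Matrix A A ℂ, (∑ j, K j * X * (K j)ᴴ).trace = X.trace) :
    ∑ j, (K j)ᴴ * K j = 1 := by
  classical
  refine ext_iff_trace_mul_right.mpr fun X => ?_
  have := trace_sum_mul_mul_conjTranspose K X 1
  rw [Matrix.one_mul, h] at this
  simp only [Matrix.mul_one] at this
  rw [← this, Matrix.one_mul]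

end Kraus

lemma inner_toLp_mulVec {A A' B : Type*} [Fintype A] [Fintype A'] [Fintype B]
    (M : Matrix B A ℂ) (N : Matrix B A' ℂ) (x : A → ℂ) (y : A' → ℂ) :
    inner ℂ (WithLp.toLp 2 (M *ᵥ x)) (WithLp.toLp 2 (N *ᵥ y)) =
      star x ⬝ᵥ ((Mᴴ * N) *ᵥ y) := by
  rw [EuclideanSpace.inner_toLp_toLp, dotProduct_comm, star_mulVec, ← dotProduct_mulVec,
    mulVec_mulVec]

/-! ### Trace norm duality -/

section TraceNorm

variable {B : Type*} [Fintype B] [DecidableEq B]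

/-- Duality between the trace norm and unitary observables. -/
lemma norm_trace_mul_le_traceNorm (X M : Matrix B B ℂ) (hX : Xᴴ * X = 1) :
    ‖(X * M).trace‖ ≤ traceNorm M := by
  -- In an eigenbasis `u` of `M†M`, the `i`-th diagonal term is at most `‖X M uᵢ‖ = ‖M uᵢ‖`, the
  -- `i`-th singular value.
  have hM := isHermitian_conjTranspose_mul_self M
  let u := hM.eigenvectorBasis
  have htr : (X * M).trace =
      ∑ i, inner ℂ (u i) (WithLp.toLp 2 ((X * M) *ᵥ (u i).ofLp)) := by
    refine Eq.trans ?_ (LinearMap.trace_eq_sum_inner (toEuclideanLin (X * M)) u)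
    rw [toEuclideanLin, Matrix.toLpLin_eq_toLin, Matrix.trace_toLin_eq]
  rw [htr]
  refine (norm_sum_le _ _).trans (Finset.sum_le_sum fun i _ => ?_)
  refine (norm_inner_le_norm _ _).trans ?_
  rw [u.orthonormal.1, one_mul]
  refine Real.le_sqrt_of_sq_le (le_of_eq ?_)
  have h1 := hM.mulVec_eigenvectorBasis i
  have h2 : inner ℂ (u i) (u i) = (1 : ℂ) := by
    rw [inner_self_eq_norm_sq_to_K, u.orthonormal.1]; simp
  rw [EuclideanSpace.inner_eq_star_dotProduct, dotProduct_comm] at h2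
  rw [← inner_self_eq_norm_sq (𝕜 := ℂ), inner_toLp_mulVec, conjTranspose_mul, Matrix.mul_assoc,
    ← Matrix.mul_assoc Xᴴ, hX, Matrix.one_mul, h1, dotProduct_smul, h2]
  simp

end TraceNorm


/-! ### Overlaps of moving unit vectors -/

section Geometry

variable {V : Type*} [NormedAddCommGroup V] [InnerProductSpace ℂ V]

/-- Since `w ⟂ u`, only the part of `v` orthogonal to `u` contributes, and its squared norm is `1 -
|⟨u, v⟩|²`. -/
lemma norm_inner_sq_le_of_orthogonal {u v w : V} (hu : ‖u‖ = 1) (hv : ‖v‖ = 1)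
    (h : inner ℂ w u = 0) :
    ‖(inner ℂ w v : ℂ)‖ ^ 2 ≤ ‖w‖ ^ 2 * (1 - ‖(inner ℂ u v : ℂ)‖ ^ 2) := by
  set c : ℂ := inner ℂ u v with hc
  have h1 : (inner ℂ w v : ℂ) = inner ℂ w (v - c • u) := by
    rw [inner_sub_right, inner_smul_right, h, mul_zero, sub_zero]
  have h2 : ‖v - c • u‖ ^ 2 = 1 - ‖c‖ ^ 2 := by
    have h3 : inner ℂ v (c • u) = ((‖c‖ ^ 2 : ℝ) : ℂ) := by
      rw [inner_smul_right, ← inner_conj_symm, ← hc, Complex.mul_conj, Complex.normSq_eq_norm_sq]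
    rw [norm_sub_sq (𝕜 := ℂ), h3, norm_smul, hu, hv]
    simp only [RCLike.re_to_complex, Complex.ofReal_re]
    ring
  rw [h1, ← h2, ← mul_pow]
  exact pow_le_pow_left₀ (norm_nonneg _) (norm_inner_le_norm _ _) 2

/-- If two unit vectors move with velocities that are orthogonal to them, their overlap changes
slowly when it is close to one in modulus. -/
lemma norm_deriv_overlap_sq_le {v₀ v₁ w₀ w₁ : V} (hv₀ : ‖v₀‖ = 1) (hv₁ : ‖v₁‖ = 1)
    (h₀ : inner ℂ w₀ v₀ = 0) (h₁ : inner ℂ w₁ v₁ = 0) {a : ℝ}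
    (ha₀ : ‖w₀‖ ^ 2 ≤ a) (ha₁ : ‖w₁‖ ^ 2 ≤ a) :
    ‖(inner ℂ v₀ w₁ + inner ℂ w₀ v₁ : ℂ)‖ ^ 2 ≤ 4 * a * (1 - ‖(inner ℂ v₀ v₁ : ℂ)‖ ^ 2) := by
  have hF : 0 ≤ 1 - ‖(inner ℂ v₀ v₁ : ℂ)‖ ^ 2 := by
    have := norm_inner_le_norm (𝕜 := ℂ) v₀ v₁
    rw [hv₀, hv₁, one_mul] at this
    nlinarith [norm_nonneg (inner ℂ v₀ v₁ : ℂ)]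
  have e₀ := norm_inner_sq_le_of_orthogonal hv₀ hv₁ h₀
  have e₁ := norm_inner_sq_le_of_orthogonal hv₁ hv₀ h₁
  rw [norm_inner_symm w₁, norm_inner_symm v₁] at e₁
  have k₀ := mul_le_mul_of_nonneg_right ha₀ hF
  have k₁ := mul_le_mul_of_nonneg_right ha₁ hF
  have ht := norm_add_le (inner ℂ v₀ w₁ : ℂ) (inner ℂ w₀ v₁)
  have hs := pow_le_pow_left₀ (norm_nonneg _) ht 2
  nlinarith [sq_nonneg (‖(inner ℂ v₀ w₁ : ℂ)‖ - ‖(inner ℂ w₀ v₁ : ℂ)‖)]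

end Geometry

section Stack

lemma sum_conjTranspose_mul_mul {J A B : Type*} [Fintype J] [Fintype B]
    (X : Matrix B B ℂ) (K M : J → Matrix B A ℂ) :
    ∑ j, (K j)ᴴ * (X * M j) = ∑ j, (K j)ᴴ * X * M j := by
  simp only [Matrix.mul_assoc]

variable {J A B : Type*} [Fintype J] [Fintype A] [Fintype B]

/-- The operator `∑ⱼ |j⟩ ⊗ Kⱼ`. -/
def stack (K : J → Matrix B A ℂ) : Matrix (J × B) A ℂ :=
  Matrix.of fun p a => K p.1 p.2 a

lemma inner_stack (K M : J → Matrix B A ℂ) (x y : A → ℂ) :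
    inner ℂ (WithLp.toLp 2 (stack K *ᵥ x)) (WithLp.toLp 2 (stack M *ᵥ y)) =
      star x ⬝ᵥ ((∑ j, (K j)ᴴ * M j) *ᵥ y) := by
  rw [inner_toLp_mulVec]
  congr 2
  ext i i'
  simp [stack, Matrix.sum_apply, mul_apply, Fintype.sum_prod_type]

lemma norm_stack_sq (K : J → Matrix B A ℂ) (x : A → ℂ) :
    ‖WithLp.toLp 2 (stack K *ᵥ x)‖ ^ 2 = (star x ⬝ᵥ ((∑ j, (K j)ᴴ * K j) *ᵥ x)).re := by
  rw [← inner_stack, ← inner_self_eq_norm_sq (𝕜 := ℂ)]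
  rfl

lemma hasDerivAt_stack_mulVec {K : ℝ → J → Matrix B A ℂ} {K' : J → Matrix B A ℂ} {θ : ℝ}
    (h : ∀ j b a, HasDerivAt (fun t => K t j b a) (K' j b a) θ) (x : A → ℂ) :
    HasDerivAt (fun t => WithLp.toLp 2 (stack (K t) *ᵥ x)) (WithLp.toLp 2 (stack K' *ᵥ x)) θ := by
  have h1 : HasDerivAt (fun t => stack (K t) *ᵥ x) (stack K' *ᵥ x) θ := by
    refine hasDerivAt_pi.mpr fun p => ?_
    simp only [mulVec, dotProduct, stack, of_apply]
    exact HasDerivAt.fun_sum fun a _ => (h p.1 p.2 a).mul_const _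
  exact (PiLp.hasStrictFDerivAt_toLp (𝕜 := ℝ) 2 _).hasFDerivAt.comp_hasDerivAt θ h1

/-- A quantitative tradeoff for a differentiable Kraus family `N` whose action on the coherence
`|e₁⟩⟨e₀|` is a rotation at speed `δ`, as seen by the unitary observable `X`. -/
lemma speed_sq_mul_overlap_sq_le [DecidableEq A] [DecidableEq B] {N : ℝ → J → Matrix B A ℂ}
    {N' : J → Matrix B A ℂ}
    {θ : ℝ} (hder : ∀ j b a, HasDerivAt (fun t => N t j b a) (N' j b a) θ)
    (horth : ∑ j, (N' j)ᴴ * N θ j = 0) (hone : ∑ j, (N θ j)ᴴ * N θ j = 1)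
    {X : Matrix B B ℂ} (hX : Xᴴ * X = 1) {e₀ e₁ : A → ℂ}
    (he₀ : star e₀ ⬝ᵥ e₀ = 1) (he₁ : star e₁ ⬝ᵥ e₁ = 1) {a : ℝ}
    (ha₀ : (star e₀ ⬝ᵥ ((∑ j, (N' j)ᴴ * N' j) *ᵥ e₀)).re ≤ a)
    (ha₁ : (star e₁ ⬝ᵥ ((∑ j, (N' j)ᴴ * N' j) *ᵥ e₁)).re ≤ a) {δ : ℝ} {m : ℂ}
    (hm : ∀ t, star e₀ ⬝ᵥ ((∑ j, (N t j)ᴴ * X * N t j) *ᵥ e₁) =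
      Complex.exp (-(Complex.I * t) * δ) * m) :
    δ ^ 2 * ‖star e₀ ⬝ᵥ ((∑ j, (N θ j)ᴴ * X * N θ j) *ᵥ e₁)‖ ^ 2 ≤
      4 * a * (1 - ‖star e₀ ⬝ᵥ ((∑ j, (N θ j)ᴴ * X * N θ j) *ᵥ e₁)‖ ^ 2) := by
  have hderX : ∀ j b a, HasDerivAt (fun t => (X * N t j) b a) ((X * N' j) b a) θ := by
    intro j b a
    simp only [mul_apply]
    exact HasDerivAt.fun_sum fun b' _ => (hder j b' a).const_mul _
  have hXX : ∀ M M' : Matrix B A ℂ, (X * M)ᴴ * (X * M') = Mᴴ * M' := by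
    intro M M'
    rw [conjTranspose_mul, Matrix.mul_assoc, ← Matrix.mul_assoc Xᴴ, hX, Matrix.one_mul]
  -- The overlap is differentiated twice, by the product rule and through the explicit phase `hm`;
  -- the two values must agree.
  have d := (hasDerivAt_stack_mulVec hder e₀).inner ℂ (hasDerivAt_stack_mulVec hderX e₁)
  simp only [inner_stack (N _) (fun j => X * N _ j), sum_conjTranspose_mul_mul, hm] at d
  have d' : HasDerivAt (fun t : ℝ => Complex.exp (-(Complex.I * t) * δ) * m)
      (Complex.exp (-(Complex.I * θ) * δ) * (-Complex.I * δ) * m) θ := by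
    have : HasDerivAt (fun t : ℝ => -(Complex.I * t) * (δ : ℂ)) (-Complex.I * δ) θ := by
      have := (((hasDerivAt_id (θ : ℂ)).comp_ofReal).const_mul Complex.I).neg.mul_const (δ : ℂ)
      simpa using this
    exact this.cexp.mul_const m
  have hd := d.unique d'
  have key := norm_deriv_overlap_sq_le
    (v₀ := WithLp.toLp 2 (stack (N θ) *ᵥ e₀)) (v₁ := WithLp.toLp 2 (stack (fun j => X * N θ j) *ᵥ e₁))
    (w₀ := WithLp.toLp 2 (stack N' *ᵥ e₀)) (w₁ := WithLp.toLp 2 (stack (fun j => X * N' j) *ᵥ e₁))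
    (a := a) ?_ ?_ ?_ ?_ ?_ ?_
  · rw [hd, inner_stack, sum_conjTranspose_mul_mul] at key
    -- The derivative is `-iδ` times the overlap itself, hence the factor `δ²` on the left.
    have : Complex.exp (-(Complex.I * θ) * δ) * (-Complex.I * δ) * m =
        -Complex.I * δ * (star e₀ ⬝ᵥ ((∑ j, (N θ j)ᴴ * X * N θ j) *ᵥ e₁)) := by
      rw [hm]; ring
    rw [this, norm_mul, norm_mul, mul_pow, mul_pow] at key
    simpa using key
  · rw [← pow_eq_one_iff_of_nonneg (norm_nonneg _) two_ne_zero, norm_stack_sq, hone, one_mulVec,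
      he₀, Complex.one_re]
  · rw [← pow_eq_one_iff_of_nonneg (norm_nonneg _) two_ne_zero, norm_stack_sq]
    simp only [hXX]
    rw [hone, one_mulVec, he₁, Complex.one_re]
  · rw [inner_stack, horth, zero_mulVec, dotProduct_zero]
  · rw [inner_stack]
    simp only [hXX]
    rw [horth, zero_mulVec, dotProduct_zero]
  · rwa [norm_stack_sq]
  · rw [norm_stack_sq]
    simpa only [hXX] using ha₁

end Stack

/-! ### Operator norm and Kraus forms of compositions -/

section OpNorm

variable {A : Type*} [Fintype A] [DecidableEq A]

lemma re_dotProduct_mulVec_le_opNorm (M : Matrix A A ℂ) (x : A → ℂ) :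
    (star x ⬝ᵥ (M *ᵥ x)).re ≤ opNorm M * (star x ⬝ᵥ x).re := by
  have h1 : star x ⬝ᵥ (M *ᵥ x) =
      inner ℂ (WithLp.toLp 2 x) (toEuclideanCLM (n := A) (𝕜 := ℂ) M (WithLp.toLp 2 x)) := by
    rw [toEuclideanCLM_toLp, EuclideanSpace.inner_toLp_toLp, dotProduct_comm]
  have h2 : (star x ⬝ᵥ x).re = ‖WithLp.toLp 2 x‖ ^ 2 := by
    rw [← inner_self_eq_norm_sq (𝕜 := ℂ), EuclideanSpace.inner_toLp_toLp, dotProduct_comm]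
    rfl
  rw [h1, h2]
  refine (Complex.re_le_norm _).trans ((norm_inner_le_norm _ _).trans ?_)
  calc _ ≤ ‖WithLp.toLp 2 x‖ * (opNorm M * ‖WithLp.toLp 2 x‖) :=
        mul_le_mul_of_nonneg_left (ContinuousLinearMap.le_opNorm _ _) (norm_nonneg _)
    _ = _ := by ring

lemma opNorm_nonneg (M : Matrix A A ℂ) : 0 ≤ opNorm M := norm_nonneg _

end OpNorm


section Composition

/-- The operators `Dᵢ Mⱼ Eₖ`. -/
def sandwich {L P Q R I J K : Type*} [Fintype P] [Fintype Q] (D : I → Matrix R Q ℂ)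
    (M : J → Matrix Q P ℂ) (E : K → Matrix P L ℂ) :
    I × J × K → Matrix R L ℂ :=
  fun p => D p.1 * M p.2.1 * E p.2.2

lemma hasDerivAt_sandwich {L P Q R I J K : Type*} [Fintype P] [Fintype Q]
    (D : I → Matrix R Q ℂ) {M : ℝ → J → Matrix Q P ℂ} {M' : J → Matrix Q P ℂ} {θ : ℝ}
    (h : ∀ j b a, HasDerivAt (fun t => M t j b a) (M' j b a) θ)
    (E : K → Matrix P L ℂ) (p : I × J × K) (b : R) (a : L) :
    HasDerivAt (fun t => sandwich D (M t) E p b a) (sandwich D M' E p b a) θ := by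
  simp only [sandwich, mul_apply]
  exact HasDerivAt.fun_sum fun x _ =>
    (HasDerivAt.fun_sum fun y _ => (h _ y x).const_mul _).mul_const _

variable {L P Q R : Type*} [Fintype P] [Fintype Q]
  {I J K : Type*} [Fintype I] [Fintype J] [Fintype K]

/-- Completeness of the decoder's Kraus operators removes `D`. With `M = M'` or one of them a
derivative, this transports both the orthogonality condition and `∑ K̇†K̇` to the whole code. -/
lemma sum_sandwich_conjTranspose_mul [Fintype R] [DecidableEq Q] {D : I → Matrix R Q ℂ}
    (hD : ∑ i, (D i)ᴴ * D i = 1) (M M' : J → Matrix Q P ℂ) (E : K → Matrix P L ℂ) :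
    ∑ p, (sandwich D M E p)ᴴ * sandwich D M' E p =
      ∑ k, (E k)ᴴ * (∑ j, (M j)ᴴ * M' j) * E k := by
  have h : ∀ j k, ∑ i, (D i * M j * E k)ᴴ * (D i * M' j * E k) =
      (E k)ᴴ * ((M j)ᴴ * M' j) * E k := by
    intro j k
    have : (E k)ᴴ * ((M j)ᴴ * M' j) * E k =
        (E k)ᴴ * ((M j)ᴴ * (∑ i, (D i)ᴴ * D i) * M' j) * E k := by
      rw [hD, Matrix.mul_one]
    rw [this]
    simp only [Matrix.mul_sum, Matrix.sum_mul, conjTranspose_mul, Matrix.mul_assoc]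
  simp only [sandwich, Fintype.sum_prod_type]
  rw [Finset.sum_comm]
  refine (Finset.sum_congr rfl fun j _ => Finset.sum_comm.trans
    (Finset.sum_congr rfl fun k _ => h j k)).trans ?_
  rw [Finset.sum_comm]
  simp only [Matrix.mul_sum, Matrix.sum_mul]

lemma sum_sandwich_mul_mul_conjTranspose [Fintype L] (D : I → Matrix R Q ℂ) (M : J → Matrix Q P ℂ)
    (E : K → Matrix P L ℂ) (X : Matrix L L ℂ) :
    ∑ p, sandwich D M E p * X * (sandwich D M E p)ᴴ =
      ∑ i, D i * (∑ j, M j * (∑ k, E k * X * (E k)ᴴ) * (M j)ᴴ) * (D i)ᴴ := by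
  simp only [sandwich, Fintype.sum_prod_type, Matrix.mul_sum, Matrix.sum_mul, conjTranspose_mul,
    Matrix.mul_assoc]

/-- The vectors `Eₖ x` have squared norms summing to one, so encoding cannot raise an expectation
above `opNorm α`. -/
lemma re_dotProduct_sum_conj_mulVec_le [Fintype L] [DecidableEq L] [DecidableEq P]
    {E : K → Matrix P L ℂ} (hE : ∑ k, (E k)ᴴ * E k = 1) (α : Matrix P P ℂ) {x : L → ℂ} (hx : star x ⬝ᵥ x = 1) :
    (star x ⬝ᵥ ((∑ k, (E k)ᴴ * α * E k) *ᵥ x)).re ≤ opNorm α := by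
  have h : ∀ β : Matrix P P ℂ, star x ⬝ᵥ ((∑ k, (E k)ᴴ * β * E k) *ᵥ x) =
      ∑ k, star (E k *ᵥ x) ⬝ᵥ (β *ᵥ (E k *ᵥ x)) := by
    intro β
    rw [sum_mulVec, dotProduct_sum]
    refine Finset.sum_congr rfl fun k _ => ?_
    rw [star_mulVec, ← dotProduct_mulVec, mulVec_mulVec, mulVec_mulVec, Matrix.mul_assoc]
  have h1 := h 1
  simp only [Matrix.mul_one, one_mulVec] at h1
  rw [hE, one_mulVec, hx] at h1
  rw [h, Complex.re_sum]
  calc _ ≤ ∑ k, opNorm α * (star (E k *ᵥ x) ⬝ᵥ (E k *ᵥ x)).re :=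
        Finset.sum_le_sum fun k _ => re_dotProduct_mulVec_le_opNorm _ _
    _ = opNorm α := by
        rw [← Finset.mul_sum, ← Complex.re_sum, ← h1, Complex.one_re, mul_one]

end Composition

lemma star_star_dotProduct {A : Type*} [Fintype A] (x y : A → ℂ) :
    star (star x ⬝ᵥ y) = star y ⬝ᵥ x := by
  rw [← star_dotProduct_star, star_star]

/-! ### The observable and the code error -/

section Reflection

variable {A : Type*} [Fintype A] [DecidableEq A]

/-- The reflection that exchanges two orthonormal vectors. -/
lemma exists_hermitian_unitary_mulVec_eq {g₀ g₁ : A → ℂ} (h₀ : star g₀ ⬝ᵥ g₀ = 1)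
    (h₁ : star g₁ ⬝ᵥ g₁ = 1) (h : star g₀ ⬝ᵥ g₁ = 0) :
    ∃ X : Matrix A A ℂ, Xᴴ = X ∧ Xᴴ * X = 1 ∧ X *ᵥ g₁ = g₀ := by
  have h' : star g₁ ⬝ᵥ g₀ = 0 := by
    rw [← star_star_dotProduct, h, star_zero]
  -- Since `‖v‖² = 2`, the reflection along `v` is `1 - v v†`, without a prefactor.
  let v := g₀ - g₁
  have hv : star v ⬝ᵥ v = 2 := by
    simp only [v, star_sub, sub_dotProduct, dotProduct_sub, h₀, h₁, h, h']
    norm_num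
  have hX : (1 - vecMulVec v (star v))ᴴ = 1 - vecMulVec v (star v) := by
    simp [conjTranspose_vecMulVec]
  refine ⟨1 - vecMulVec v (star v), hX, ?_, ?_⟩
  · rw [hX, Matrix.sub_mul, Matrix.mul_sub, Matrix.mul_sub, vecMulVec_mul_vecMulVec, hv]
    simp only [Matrix.mul_one, Matrix.one_mul, vecMulVec_smul]
    module
  · rw [sub_mulVec, one_mulVec, vecMulVec_mulVec]
    have : star v ⬝ᵥ g₁ = -1 := by simp [v, sub_dotProduct, h, h₁]
    rw [this]
    simp [v]

end Reflection

section DiamondError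

variable {A B : Type*} [Fintype A] [Fintype B] [DecidableEq B]

/-- The diamond error bounds the distinguishability by a unitary observable of the outputs on
an input state without a reference system. -/
lemma norm_trace_mul_sub_le {Φ Ψ : Matrix A A ℂ →ₗ[ℂ] Matrix B B ℂ} {ε : ℝ} (hε : 0 ≤ ε)
    (h : diamondError Φ Ψ ≤ ENNReal.ofReal ε) {X : Matrix B B ℂ} (hX : Xᴴ * X = 1)
    {ρ : Matrix A A ℂ} (hρ : ρ.PosSemidef) (htr : ρ.trace = 1) :
    ‖(X * (Φ ρ - Ψ ρ)).trace‖ ≤ 2 * ε := by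
  -- A one-dimensional reference system suffices.
  let f : A × Fin 1 → A := Prod.fst
  let e : B × Fin 1 ≃ B := Equiv.prodUnique B (Fin 1)
  have hσtr : (ρ.submatrix f f).trace = 1 := by
    rw [← htr]
    simp [trace, f, Fintype.sum_prod_type]
  have h1 : ENNReal.ofReal (1 / 2 * traceNorm
      (ampliate 1 Φ (ρ.submatrix f f) - ampliate 1 Ψ (ρ.submatrix f f))) ≤ ENNReal.ofReal ε := by
    refine le_trans ?_ h
    exact le_iSup_of_le 1 (le_iSup_of_le (ρ.submatrix f f)
      (le_iSup_of_le ⟨hρ.submatrix f, hσtr⟩ le_rfl))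
  rw [ENNReal.ofReal_le_ofReal_iff hε] at h1
  have h2 : ampliate 1 Φ (ρ.submatrix f f) - ampliate 1 Ψ (ρ.submatrix f f) =
      (Φ ρ - Ψ ρ).submatrix e e := by
    ext p q
    rfl
  rw [h2] at h1
  have h3 := norm_trace_mul_le_traceNorm (X.submatrix e e) ((Φ ρ - Ψ ρ).submatrix e e) (by
    rw [conjTranspose_submatrix, submatrix_mul_equiv, hX, submatrix_one_equiv])
  rw [submatrix_mul_equiv] at h3
  have h4 : ((X * (Φ ρ - Ψ ρ)).submatrix e e).trace = (X * (Φ ρ - Ψ ρ)).trace :=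
    e.sum_comp fun b => (X * (Φ ρ - Ψ ρ)) b b
  rw [h4] at h3
  linarith

end DiamondError

section Overlap

variable {A : Type*} [Fintype A]

/-- Polarization: for Hermitian `T`, the real part is a quarter of the difference of the
expectations at `e₀ ± e₁`, both of squared norm `2`. -/
lemma abs_re_offdiag_le {T : Matrix A A ℂ} (hT : Tᴴ = T) {c : ℝ}
    (h : ∀ s : A → ℂ, star s ⬝ᵥ s = 2 → |(star s ⬝ᵥ (T *ᵥ s)).re| ≤ c)
    {e₀ e₁ : A → ℂ} (h₀ : star e₀ ⬝ᵥ e₀ = 1) (h₁ : star e₁ ⬝ᵥ e₁ = 1)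
    (h01 : star e₀ ⬝ᵥ e₁ = 0) :
    |(star e₀ ⬝ᵥ (T *ᵥ e₁)).re| ≤ c / 2 := by
  have h10 : star e₁ ⬝ᵥ e₀ = 0 := by
    rw [← star_star_dotProduct, h01, star_zero]
  have hs : (star e₁ ⬝ᵥ (T *ᵥ e₀)).re = (star e₀ ⬝ᵥ (T *ᵥ e₁)).re := by
    rw [← star_star_dotProduct, star_mulVec, hT, ← dotProduct_mulVec]
    rfl
  have hp := h (e₀ + e₁) (by
    simp only [star_add, add_dotProduct, dotProduct_add, h₀, h₁, h01, h10]; norm_num)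
  have hm := h (e₀ - e₁) (by
    simp only [star_sub, sub_dotProduct, dotProduct_sub, h₀, h₁, h01, h10]; norm_num)
  simp only [star_add, star_sub, add_dotProduct, sub_dotProduct, dotProduct_add, dotProduct_sub,
    mulVec_add, mulVec_sub, Complex.add_re, Complex.sub_re, hs] at hp hm
  rw [abs_le] at hp hm ⊢
  constructor <;> linarith [hp.1, hp.2, hm.1, hm.2]

lemma trace_mul_vecMulVec_star (Z : Matrix A A ℂ) (x y : A → ℂ) :
    (Z * vecMulVec x (star y)).trace = star y ⬝ᵥ (Z *ᵥ x) := by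
  rw [mul_vecMulVec, trace_vecMulVec, dotProduct_comm]

end Overlap


/-! ### The bound for a one-parameter group -/

section Bound

variable {L P Q : Type*} [Fintype L] [DecidableEq L] [Fintype P] [DecidableEq P] [Fintype Q]

/-- A unitary observable that is `1` on the target coherence `|U e₁⟩⟨U e₀|` has an expectation
close to `1` on the coherence produced by a channel close to `U`. -/
lemma one_sub_le_norm_coherence {J : Type*} [Fintype J] {Φ : Matrix L L ℂ →ₗ[ℂ] Matrix L L ℂ}
    {N : J → Matrix L L ℂ} (hN : ∀ Y, Φ Y = ∑ j, N j * Y * (N j)ᴴ) {U : Matrix L L ℂ} {ε : ℝ}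
    (hε : 0 ≤ ε) (h : diamondError Φ (conjMap U) ≤ ENNReal.ofReal ε) {X : Matrix L L ℂ}
    (hXh : Xᴴ = X) (hX : Xᴴ * X = 1) {e₀ e₁ : L → ℂ} (he₀ : star e₀ ⬝ᵥ e₀ = 1)
    (he₁ : star e₁ ⬝ᵥ e₁ = 1) (he : star e₀ ⬝ᵥ e₁ = 0)
    (hU : star e₀ ⬝ᵥ ((Uᴴ * X * U) *ᵥ e₁) = 1) :
    1 - 2 * ε ≤ ‖star e₀ ⬝ᵥ ((∑ j, (N j)ᴴ * X * N j) *ᵥ e₁)‖ := by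
  let T := (∑ j, (N j)ᴴ * X * N j) - Uᴴ * X * U
  have hT : Tᴴ = T := by
    simp only [T, conjTranspose_sub, conjTranspose_sum, conjTranspose_mul,
      conjTranspose_conjTranspose, hXh, Matrix.mul_assoc]
  have htr : ∀ Y, (X * (Φ Y - conjMap U Y)).trace = (T * Y).trace := by
    intro Y
    rw [hN, conjMap_apply, Matrix.mul_sub, trace_sub, trace_sum_mul_mul_conjTranspose]
    have := trace_sum_mul_mul_conjTranspose (fun _ : Unit => U) Y X
    simp only [Finset.univ_unique, Finset.sum_singleton] at this
    rw [this, ← trace_sub, ← Matrix.sub_mul]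
  -- The state is `s s† / 2`, so its bound `2ε` becomes `4ε` for `s`; polarization then halves it.
  have hb : ∀ s : L → ℂ, star s ⬝ᵥ s = 2 → |(star s ⬝ᵥ (T *ᵥ s)).re| ≤ 4 * ε := by
    intro s hs
    have hρ : ((2⁻¹ : ℂ) • vecMulVec s (star s)).PosSemidef :=
      (posSemidef_vecMulVec_self_star s).smul (inv_nonneg.mpr zero_le_two)
    have hρ1 : ((2⁻¹ : ℂ) • vecMulVec s (star s)).trace = 1 := by
      rw [trace_smul, trace_vecMulVec, dotProduct_comm, hs]; norm_num
    have := norm_trace_mul_sub_le hε h hX hρ hρ1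
    rw [htr, Matrix.mul_smul, trace_smul, trace_mul_vecMulVec_star, smul_eq_mul, norm_mul] at this
    have h2 := Complex.abs_re_le_norm (star s ⬝ᵥ (T *ᵥ s))
    norm_num at this
    linarith
  have key := abs_re_offdiag_le hT hb he₀ he₁ he
  simp only [T, sub_mulVec, dotProduct_sub, hU, Complex.sub_re, Complex.one_re] at key
  have := Complex.re_le_norm (star e₀ ⬝ᵥ ((∑ j, (N j)ᴴ * X * N j) *ᵥ e₁))
  rw [abs_le] at key
  linarith [key.1]

lemma IsChannel.comp {A B R : Type*} [Fintype A] [Fintype B] [Fintype R]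
    {Φ : Matrix A A ℂ →ₗ[ℂ] Matrix B B ℂ} {Ψ : Matrix B B ℂ →ₗ[ℂ] Matrix R R ℂ}
    (hΨ : IsChannel Ψ) (hΦ : IsChannel Φ) : IsChannel (Ψ ∘ₗ Φ) where
  completely_positive k X hX := hΨ.completely_positive k _ (hΦ.completely_positive k X hX)
  trace_preserving X := by
    rw [LinearMap.comp_apply, hΨ.trace_preserving, hΦ.trace_preserving]

lemma trace_conjMap {U : Matrix L L ℂ} (hU : Uᴴ * U = 1) (X : Matrix L L ℂ) :
    (conjMap U X).trace = X.trace := by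
  rw [conjMap_apply, trace_mul_comm, ← Matrix.mul_assoc, hU, Matrix.one_mul]

/-- The tradeoff between the error of a code and the derivative of a Kraus form of the noise,
for a pair of energy eigenvectors of the logical system. -/
lemma energy_gap_sq_le {HL : Matrix L L ℂ} (hHL : HL.IsHermitian) {UP : ℝ → Matrix P P ℂ}
    {E : Matrix L L ℂ →ₗ[ℂ] Matrix P P ℂ} {C : Matrix P P ℂ →ₗ[ℂ] Matrix Q Q ℂ}
    {D : Matrix Q Q ℂ →ₗ[ℂ] Matrix L L ℂ} (hE : IsChannel E) (hC : IsChannel C)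
    (hD : IsChannel D) (hcov : IsCovariant (evolution HL) UP E) {θ ε : ℝ} (hε : 0 ≤ ε)
    (hε' : ε ≤ 1 / 4)
    (hd : diamondError (D ∘ₗ C ∘ₗ conjMap (UP θ) ∘ₗ E) (conjMap (evolution HL θ)) ≤
      ENNReal.ofReal ε)
    {r : ℕ} {K : ℝ → Fin r → Matrix Q P ℂ} {K' : Fin r → Matrix Q P ℂ}
    (hK : ∀ t, IsKrausForm (C ∘ₗ conjMap (UP t)) (K t))
    (hder : ∀ l b a, HasDerivAt (fun t => K t l b a) (K' l b a) θ)
    (horth : ∑ l, (K' l)ᴴ * K θ l = 0) {e₀ e₁ : L → ℂ} {a₀ a₁ : ℝ}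
    (he₀ : star e₀ ⬝ᵥ e₀ = 1) (he₁ : star e₁ ⬝ᵥ e₁ = 1) (he : star e₀ ⬝ᵥ e₁ = 0)
    (hv₀ : HL *ᵥ e₀ = (a₀ : ℂ) • e₀) (hv₁ : HL *ᵥ e₁ = (a₁ : ℂ) • e₁) :
    (a₁ - a₀) ^ 2 ≤ 64 * ε * opNorm (∑ l, (K' l)ᴴ * K' l) := by
  classical
  obtain ⟨rE, KE, hKE⟩ := hE.exists_isKrausForm
  obtain ⟨rD, KD, hKD⟩ := hD.exists_isKrausForm
  have hKE1 : ∑ k, (KE k)ᴴ * KE k = 1 :=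
    sum_conjTranspose_mul_eq_one fun X => by rw [← hKE X, hE.trace_preserving]
  have hKD1 : ∑ k, (KD k)ᴴ * KD k = 1 :=
    sum_conjTranspose_mul_eq_one fun X => by rw [← hKD X, hD.trace_preserving]
  let U := evolution HL
  have hUU : ∀ t, (U t)ᴴ * U t = 1 := fun t =>
    mul_eq_one_comm.mp (evolution_mul_conjTranspose hHL t)
  let N : ℝ → Fin rD × Fin r × Fin rE → Matrix L L ℂ := fun t => sandwich KD (K t) KE
  let N' := sandwich KD K' KE
  -- Covariance moves the whole `t`-dependence into the logical rotation.
  have hcomp : ∀ t, D ∘ₗ C ∘ₗ conjMap (UP t) ∘ₗ E = (D ∘ₗ C ∘ₗ E) ∘ₗ conjMap (U t) := by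
    intro t
    rw [← hcov t]
    rfl
  have hN : ∀ t Y, (D ∘ₗ C ∘ₗ conjMap (UP t) ∘ₗ E) Y = ∑ j, N t j * Y * (N t j)ᴴ := by
    intro t Y
    rw [sum_sandwich_mul_mul_conjTranspose, ← hKE Y, ← hK t, ← hKD]
    rfl
  have hNder : ∀ j b a, HasDerivAt (fun t => N t j b a) (N' j b a) θ :=
    hasDerivAt_sandwich KD hder KE
  have hNorth : ∑ j, (N' j)ᴴ * N θ j = 0 := by
    rw [sum_sandwich_conjTranspose_mul hKD1, horth]
    simp
  have hNone : ∑ j, (N θ j)ᴴ * N θ j = 1 :=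
    sum_conjTranspose_mul_eq_one fun X => by
      rw [← hN, hcomp, LinearMap.comp_apply, (hD.comp (hC.comp hE)).trace_preserving,
        trace_conjMap (hUU θ)]
  have hα : ∀ x : L → ℂ, star x ⬝ᵥ x = 1 →
      (star x ⬝ᵥ ((∑ j, (N' j)ᴴ * N' j) *ᵥ x)).re ≤ opNorm (∑ l, (K' l)ᴴ * K' l) := by
    intro x hx
    rw [sum_sandwich_conjTranspose_mul hKD1]
    exact re_dotProduct_sum_conj_mulVec_le hKE1 _ hx
  have hg : ∀ x y : L → ℂ, star (U θ *ᵥ x) ⬝ᵥ (U θ *ᵥ y) = star x ⬝ᵥ y := by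
    intro x y
    rw [star_mulVec, ← dotProduct_mulVec, mulVec_mulVec, hUU, one_mulVec]
  -- `X` is adapted to the fixed time `θ` and stays frozen while `t` varies in `hm`.
  obtain ⟨X, hXh, hX, hXg⟩ := exists_hermitian_unitary_mulVec_eq ((hg e₀ e₀).trans he₀)
    ((hg e₁ e₁).trans he₁) ((hg e₀ e₁).trans he)
  have hF := one_sub_le_norm_coherence (hN θ) hε hd hXh hX he₀ he₁ he (by
    rw [← mulVec_mulVec, ← mulVec_mulVec, hXg, mulVec_mulVec, hUU, one_mulVec, he₀])
  have hm : ∀ t, star e₀ ⬝ᵥ ((∑ j, (N t j)ᴴ * X * N t j) *ᵥ e₁) =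
      Complex.exp (-(Complex.I * t) * (a₁ - a₀ : ℝ)) *
        (X * (D ∘ₗ C ∘ₗ E) (vecMulVec e₁ (star e₀))).trace := by
    intro t
    rw [← trace_mul_vecMulVec_star, ← trace_sum_mul_mul_conjTranspose, ← hN, hcomp,
      LinearMap.comp_apply, conjMap_vecMulVec, evolution_mulVec_of_eigenvector hv₀,
      evolution_mulVec_of_eigenvector hv₁, star_smul, smul_vecMulVec, vecMulVec_smul, smul_smul,
      map_smul, Matrix.mul_smul, trace_smul, smul_eq_mul]
    congr 1
    rw [Complex.star_def, ← Complex.exp_conj, ← Complex.exp_add]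
    congr 1
    simp only [map_mul, map_neg, Complex.conj_I, Complex.conj_ofReal]
    push_cast
    ring
  have key := speed_sq_mul_overlap_sq_le hNder hNorth hNone hX he₀ he₁ (hα e₀ he₀) (hα e₁ he₁) hm
  set F := ‖star e₀ ⬝ᵥ ((∑ j, (N θ j)ᴴ * X * N θ j) *ᵥ e₁)‖
  set α := opNorm (∑ l, (K' l)ᴴ * K' l)
  have hα0 : 0 ≤ α := opNorm_nonneg _
  have hF0 : 0 < F := by linarith
  -- This is `(1 + 16ε)(1 - 2ε)² ≥ 1`, valid for `0 ≤ ε ≤ 1/4`.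
  have hFε : 1 - F ^ 2 ≤ 16 * ε * F ^ 2 := by
    have h1 : (1 - 2 * ε) ^ 2 ≤ F ^ 2 := pow_le_pow_left₀ (by linarith) hF 2
    nlinarith [mul_nonneg hε (sub_nonneg.mpr hε'), mul_le_mul_of_nonneg_left h1
      (by linarith : (0 : ℝ) ≤ 1 + 16 * ε), mul_nonneg (mul_nonneg hε hε) (sub_nonneg.mpr hε')]
  refine le_of_mul_le_mul_right ?_ (pow_pos hF0 2)
  calc (a₁ - a₀) ^ 2 * F ^ 2 ≤ 4 * α * (1 - F ^ 2) := key
    _ ≤ 4 * α * (16 * ε * F ^ 2) := mul_le_mul_of_nonneg_left hFε (by linarith)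
    _ = 64 * ε * α * F ^ 2 := by ring

/-- The extreme eigenvalues are attained in an orthonormal eigenbasis; if at the same index, the
spread is zero. -/
lemma spectralSpread_sq_le {HL : Matrix L L ℂ} [Nonempty L] (hHL : HL.IsHermitian) {b : ℝ}
    (hb : 0 ≤ b)
    (h : ∀ (e₀ e₁ : L → ℂ) (a₀ a₁ : ℝ), star e₀ ⬝ᵥ e₀ = 1 → star e₁ ⬝ᵥ e₁ = 1 →
      star e₀ ⬝ᵥ e₁ = 0 → HL *ᵥ e₀ = (a₀ : ℂ) • e₀ → HL *ᵥ e₁ = (a₁ : ℂ) • e₁ →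
      (a₁ - a₀) ^ 2 ≤ b) :
    spectralSpread hHL ^ 2 ≤ b := by
  obtain ⟨i, hi⟩ := exists_eq_ciInf_of_finite (f := hHL.eigenvalues)
  obtain ⟨j, hj⟩ := exists_eq_ciSup_of_finite (f := hHL.eigenvalues)
  rw [spectralSpread, ← hi, ← hj]
  by_cases hij : i = j
  · simpa [hij] using hb
  have ho : ∀ k l, star (hHL.eigenvectorBasis k).ofLp ⬝ᵥ (hHL.eigenvectorBasis l).ofLp =
      if k = l then 1 else 0 := by
    intro k l
    rw [← orthonormal_iff_ite.mp hHL.eigenvectorBasis.orthonormal k l,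
      EuclideanSpace.inner_eq_star_dotProduct, dotProduct_comm]
  refine h _ _ _ _ ((ho i i).trans (if_pos rfl)) ((ho j j).trans (if_pos rfl))
    ((ho i j).trans (if_neg hij)) ?_ ?_
  · rw [hHL.mulVec_eigenvectorBasis i]; rfl
  · rw [hHL.mulVec_eigenvectorBasis j]; rfl

/-- The lower bound on the error of a code that is covariant under a one-parameter group. -/
lemma spectralSpread_sq_div_fisherUpperBound_le [Nonempty L] {HL : Matrix L L ℂ}
    (hHL : HL.IsHermitian) {UP : ℝ → Matrix P P ℂ}
    {E : Matrix L L ℂ →ₗ[ℂ] Matrix P P ℂ} {C : Matrix P P ℂ →ₗ[ℂ] Matrix Q Q ℂ}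
    {D : Matrix Q Q ℂ →ₗ[ℂ] Matrix L L ℂ} (hE : IsChannel E) (hC : IsChannel C)
    (hD : IsChannel D) (hcov : IsCovariant (evolution HL) UP E) {θ : ℝ} {ε : ℝ≥0∞}
    (hε : ε ≤ 1 / 4)
    (hd : diamondError (D ∘ₗ C ∘ₗ conjMap (UP θ) ∘ₗ E) (conjMap (evolution HL θ)) ≤ ε) :
    ENNReal.ofReal (spectralSpread hHL ^ 2) /
      (16 * fisherUpperBound (fun t => C ∘ₗ conjMap (UP t)) θ) ≤ ε := by
  have hεtop : ε ≠ ∞ := ne_top_of_le_ne_top (by norm_num) hε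
  obtain ⟨x, hx, rfl⟩ : ∃ x : ℝ, 0 ≤ x ∧ ε = ENNReal.ofReal x :=
    ⟨ε.toReal, ENNReal.toReal_nonneg, (ENNReal.ofReal_toReal hεtop).symm⟩
  have hx' : x ≤ 1 / 4 := by
    have : (1 / 4 : ℝ≥0∞) = ENNReal.ofReal (1 / 4) := by
      rw [ENNReal.ofReal_div_of_pos (by norm_num)]; simp
    rwa [this, ENNReal.ofReal_le_ofReal_iff (by norm_num)] at hε
  have hreal : ∀ (r : ℕ) (K : ℝ → Fin r → Matrix Q P ℂ) (K' : Fin r → Matrix Q P ℂ),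
      ((∀ t, IsKrausForm (C ∘ₗ conjMap (UP t)) (K t)) ∧
        (∀ l b a, HasDerivAt (fun t => K t l b a) (K' l b a) θ) ∧
        ∑ l, (K' l)ᴴ * K θ l = 0) →
      spectralSpread hHL ^ 2 ≤ 64 * x * opNorm (∑ l, (K' l)ᴴ * K' l) := by
    rintro r K K' ⟨hK, hder, horth⟩
    have := opNorm_nonneg (∑ l, (K' l)ᴴ * K' l)
    exact spectralSpread_sq_le hHL (by positivity) fun e₀ e₁ a₀ a₁ h₀ h₁ h hv₀ hv₁ =>
      energy_gap_sq_le hHL hE hC hD hcov hx hx' hd hK hder horth h₀ h₁ h hv₀ hv₁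
  by_cases hF : fisherUpperBound (fun t => C ∘ₗ conjMap (UP t)) θ = ∞
  · simp [hF]
  refine ENNReal.div_le_of_le_mul ?_
  -- The infimum is reached by dividing by `16 x`. For `x = 0`, one admissible Kraus form, which
  -- exists because the infimum is finite, already forces the spread to vanish.
  rcases hx.eq_or_lt with rfl | hxpos
  · have : ∃ (r : ℕ) (K : ℝ → Fin r → Matrix Q P ℂ) (K' : Fin r → Matrix Q P ℂ),
        (∀ t, IsKrausForm (C ∘ₗ conjMap (UP t)) (K t)) ∧
        (∀ l b a, HasDerivAt (fun t => K t l b a) (K' l b a) θ) ∧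
        ∑ l, (K' l)ᴴ * K θ l = 0 := by
      by_contra hno
      push Not at hno
      refine hF ?_
      simp only [fisherUpperBound, iInf_eq_top]
      rintro r K K' ⟨h1, h2, h3⟩
      exact absurd h3 (hno r K K' h1 h2)
    obtain ⟨r, K, K', h⟩ := this
    have := hreal r K K' h
    rw [ENNReal.ofReal_eq_zero.mpr (by linarith)]
    exact zero_le
  · have hc0 : ENNReal.ofReal x * 16 ≠ 0 := by simpa using hxpos
    have hct : ENNReal.ofReal x * 16 ≠ ∞ := ENNReal.mul_ne_top ENNReal.ofReal_ne_top (by norm_num)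
    rw [← mul_assoc, mul_comm, ← ENNReal.div_le_iff_le_mul (Or.inl hc0) (Or.inl hct)]
    refine le_iInf fun r => le_iInf fun K => le_iInf fun K' => le_iInf fun h => ?_
    rw [ENNReal.div_le_iff_le_mul (Or.inl hc0) (Or.inl hct),
      show (16 : ℝ≥0∞) = ENNReal.ofReal 16 by simp, ← ENNReal.ofReal_mul hx,
      ← ENNReal.ofReal_mul (by linarith [opNorm_nonneg (∑ l, (K' l)ᴴ * K' l)])]
    refine ENNReal.ofReal_le_ofReal ((hreal r K K' h).trans (le_of_eq ?_))
    ring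

end Bound

/-! ### Reduction of `SU(d)` to a one-parameter group -/

section SpecialUnitary

variable {d n : ℕ}

lemma transversal_smul (S : Finset (Fin n)) (c : ℂ) (V : Matrix (Fin d) (Fin d) ℂ) :
    transversal S (c • V) = c ^ S.card • transversal S V := by
  ext a b
  have h : ∀ i, (if i ∈ S then c • V else 1) (a i) (b i) =
      (if i ∈ S then c else 1) * (if i ∈ S then V else 1) (a i) (b i) := by
    intro i
    split_ifs <;> simp
  simp only [transversal, of_apply, Matrix.smul_apply, smul_eq_mul, h, Finset.prod_mul_distrib]
  simp

/-- A unitary is a phase times a special unitary. -/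
lemma exists_specialUnitary_smul_eq (hd : 0 < d) {V : Matrix (Fin d) (Fin d) ℂ}
    (hV : V * Vᴴ = 1) :
    ∃ (c : ℂ) (W : Matrix.specialUnitaryGroup (Fin d) ℂ), c * star c = 1 ∧ V = c • W.1 := by
  -- For a `d`-th root `c` of `det V`, the matrix `c̄ V` has determinant one.
  obtain ⟨c, hc⟩ := IsAlgClosed.exists_pow_nat_eq V.det hd
  have hdet : V.det * star V.det = 1 := by
    rw [← det_conjTranspose, ← det_mul, hV, det_one]
  have hcn : ‖c‖ = 1 := by
    have : ‖V.det‖ = 1 := by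
      have := congrArg norm hdet
      rw [norm_mul, norm_star, norm_one] at this
      nlinarith [norm_nonneg V.det]
    rw [← hc, norm_pow] at this
    exact (pow_eq_one_iff_of_nonneg (norm_nonneg _) hd.ne').mp this
  have hcc : c * star c = 1 := by
    rw [Complex.star_def, Complex.mul_conj, Complex.normSq_eq_norm_sq, hcn]; simp
  refine ⟨c, ⟨star c • V, ?_⟩, hcc, ?_⟩
  · rw [mem_specialUnitaryGroup_iff, mem_unitaryGroup_iff]
    refine ⟨?_, ?_⟩
    · rw [star_smul, star_star, star_eq_conjTranspose, Matrix.smul_mul, Matrix.mul_smul, smul_smul,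
        hV, mul_comm, hcc, one_smul]
    · rw [det_smul, Fintype.card_fin, ← hc, ← mul_pow, mul_comm, hcc, one_pow]
  · rw [smul_smul, hcc, one_smul]

end SpecialUnitary

end CovariantCode

theorem lemma4 :
    -- codes that are covariant under `U(1)` with generators `HL` (logical) and `HP` (physical)
    (∀ {L P Q : Type*} [Fintype L] [DecidableEq L] [Nonempty L] [Fintype P] [DecidableEq P]
      [Fintype Q]
      (HL : Matrix L L ℂ) (HP : Matrix P P ℂ) (hHL : HL.IsHermitian) (_ : HP.IsHermitian)
      (E : Matrix L L ℂ →ₗ[ℂ] Matrix P P ℂ) (C : Matrix P P ℂ →ₗ[ℂ] Matrix Q Q ℂ)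
      (D : Matrix Q Q ℂ →ₗ[ℂ] Matrix L L ℂ),
      IsChannel E → IsChannel C → IsChannel D →
      IsCovariant (evolution HL) (evolution HP) E →
      codeError (evolution HL) (evolution HP) E C D ≤ 1 / 4 →
      ∀ θ : ℝ,
        ENNReal.ofReal (spectralSpread hHL ^ 2) /
            (16 * fisherUpperBound (fun t => C ∘ₗ conjMap (evolution HP t)) θ) ≤
          codeError (evolution HL) (evolution HP) E C D) ∧
    -- codes on `n` qudits that are covariant under `SU(d)`, for every generator `H` on a qudit
    (∀ {Q : Type*} [Fintype Q] (d n : ℕ) (_ : 0 < d) (S : Finset (Fin n))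
      (H : Matrix (Fin d) (Fin d) ℂ) (hH : H.IsHermitian)
      (E : Matrix (Fin d) (Fin d) ℂ →ₗ[ℂ] Matrix (Fin n → Fin d) (Fin n → Fin d) ℂ)
      (C : Matrix (Fin n → Fin d) (Fin n → Fin d) ℂ →ₗ[ℂ] Matrix Q Q ℂ)
      (D : Matrix Q Q ℂ →ₗ[ℂ] Matrix (Fin d) (Fin d) ℂ),
      IsChannel E → IsChannel C → IsChannel D →
      IsCovariant (fun V : Matrix.specialUnitaryGroup (Fin d) ℂ => V.1)
        (fun V => transversal S V.1) E →
      codeError (fun V : Matrix.specialUnitaryGroup (Fin d) ℂ => V.1)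
        (fun V => transversal S V.1) E C D ≤ 1 / 4 →
      ∀ θ : ℝ,
        ENNReal.ofReal (spectralSpread hH ^ 2) /
            (16 * fisherUpperBound
              (fun t => C ∘ₗ conjMap (transversal S (evolution H t))) θ) ≤
          codeError (fun V : Matrix.specialUnitaryGroup (Fin d) ℂ => V.1)
            (fun V => transversal S V.1) E C D) := by
  refine ⟨?_, ?_⟩
  · intro L P Q _ _ _ _ _ _ HL HP hHL _ E C D hE hC hD hcov hε θ
    exact spectralSpread_sq_div_fisherUpperBound_le hHL hE hC hD hcov hε
      (le_iSup (fun t => diamondError (D ∘ₗ C ∘ₗ conjMap (evolution HP t) ∘ₗ E)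
        (conjMap (evolution HL t))) θ)
  · intro Q _ d n hd S H hH E C D hE hC hD hcov hε θ
    have : Nonempty (Fin d) := ⟨⟨0, hd⟩⟩
    -- The phase `c` becomes `c ^ S.card` on the physical side; both have modulus one and drop out
    -- of the conjugations.
    have hphase : ∀ t, ∃ W : Matrix.specialUnitaryGroup (Fin d) ℂ,
        conjMap (evolution H t) = conjMap W.1 ∧
          conjMap (transversal S (evolution H t)) = conjMap (transversal S W.1) := by
      intro t
      obtain ⟨c, W, hc, hW⟩ := exists_specialUnitary_smul_eq hd (evolution_mul_conjTranspose hH t)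
      refine ⟨W, ?_, ?_⟩
      · rw [hW, conjMap_smul c hc]
      · rw [hW, transversal_smul, conjMap_smul _ (by rw [star_pow, ← mul_pow, hc, one_pow])]
    have hcov' : IsCovariant (evolution H) (fun t => transversal S (evolution H t)) E := by
      intro t
      obtain ⟨W, h1, h2⟩ := hphase t
      rw [h1, h2]
      exact hcov W
    refine spectralSpread_sq_div_fisherUpperBound_le hH hE hC hD hcov' hε ?_
    obtain ⟨W, h1, h2⟩ := hphase θ
    rw [h1, h2]
    exact le_iSup (fun W : Matrix.specialUnitaryGroup (Fin d) ℂ =>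
      diamondError (D ∘ₗ C ∘ₗ conjMap (transversal S W.1) ∘ₗ E) (conjMap W.1)) W
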